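/- \textbf{Proposition (Exponential distribution).} Let $(\Omega,\mathcal A,\mathbb P)$ be a probability space, $\lambda>0$, $a\in\mathbb R$, and let $d\ge 1$ be an integer. For a distribution function $F$ put $F^{-1}(q)=\inf\{x\in\mathbb R: F(x)\ge q\}$, $q\in(0,1)$. Let $X_1,X_2$ be real random variables on $\Omega$ with distribution functions $F_1,F_2$, where $X_1$ has finite expectation and $X_2+a\sim\mathrm{Exp}(\lambda)$ (so that $X_2$ is supported by $[-a,\infty)$), and let $G_2$ be the distribution function of $X_2^d$. Let $U,V$ be independent random variables on $\Omega$, both uniform on $[0,1]$. Let $$M=\sup \mathbb E(Y_1Y_2^d),\qquad m=\inf \mathbb E(Y_1Y_2^d),$$ over all pairs $(Y_1,Y_2)$ of random variables on $\Omega$ with $Y_1\sim F_1$, $Y_2\sim F_2$ for which the expectation exists in $[-\infty,\infty]$. Put $R=\sqrt{U^2+4e^{-2a\lambda}}$, $$p=\frac{1+\frac{4e^{-2a\lambda}}{(U-R)^2}}{2+\frac{4e^{-2a\lambda}}{(U+R)^2}+\frac{4e^{-2a\lambda}}{(U-R)^2}},\qquad J=\mathbf 1_{\{V>p\}},\qquad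 I=\mathbf 1_{\{U>F_2(a)\}},$$ and let $$U_2=(1-I)\Big[J\Big(1+\frac{U-R}{2}\Big)+(1-J)\Big(1-\frac{U+R}{2}\Big)\Big]+I\,U\quad\text{if } d \text{ is even},\qquad U_2=U\quad\text{if } d\text{ is odd}.$$ Then $U_2$ is uniform on $[0,1]$, all expectations below exist in $[-\infty,\infty]$, and: (i) $M=\mathbb E\big(F_1^{-1}(U)\,G_2^{-1}(U)\big)$, and $M$ is attained by $(Y_1,Y_2)=(F_1^{-1}(U_1),F_2^{-1}(U_2))$ with $U_1=U$, that is, this pair has marginals $F_1,F_2$ and $\mathbb E(Y_1Y_2^d)=M$; (ii) $m=\mathbb E\big(F_1^{-1}(1-U)\,G_2^{-1}(U)\big)$, and $m$ is attained by $(Y_1,Y_2)=(F_1^{-1}(U_1),F_2^{-1}(U_2))$ with $U_1=1-U$ and the same $U_2$. -/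

import Mathlib

open MeasureTheory ProbabilityTheory

noncomputable section

/-- The generalized quantile function `F⁻¹(p) = inf {x : F x ≥ p}`, for `p ∈ (0, 1)`. -/
def quantile (F : ℝ → ℝ) (p : ℝ) : ℝ := sInf {x : ℝ | p ≤ F x}

/-- The expectation of `Z` exists in `[-∞, ∞]`: the positive and the negative part of `Z` do not
both have an infinite expectation. -/
def HasExpectation {Ω : Type*} [MeasurableSpace Ω] (P : Measure Ω) (Z : Ω → ℝ) : Prop :=
  AEMeasurable Z P ∧
    (∫⁻ ω, ENNReal.ofReal (Z ω) ∂P ≠ ⊤ ∨ ∫⁻ ω, ENNReal.ofReal (-Z ω) ∂P ≠ ⊤)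

/-- The expectation `E Z⁺ - E Z⁻` in `[-∞, ∞]`; used only where it exists. -/
def expectation {Ω : Type*} [MeasurableSpace Ω] (P : Measure Ω) (Z : Ω → ℝ) : EReal :=
  ((∫⁻ ω, ENNReal.ofReal (Z ω) ∂P : ENNReal) : EReal) -
    ((∫⁻ ω, ENNReal.ofReal (-Z ω) ∂P : ENNReal) : EReal)

/-- For integrable random variables the expectation exists and is the Bochner integral. -/
theorem expectation_eq_integral {Ω : Type*} [MeasurableSpace Ω] {P : Measure Ω} {Z : Ω → ℝ}
    (hZ : Integrable Z P) :
    HasExpectation P Z ∧ expectation P Z = ((∫ ω, Z ω ∂P : ℝ) : EReal) := by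
  have h1 : ∫⁻ ω, ENNReal.ofReal (Z ω) ∂P ≠ ⊤ := hZ.lintegral_lt_top.ne
  have h2 : ∫⁻ ω, ENNReal.ofReal (-Z ω) ∂P ≠ ⊤ := hZ.neg.lintegral_lt_top.ne
  refine ⟨⟨hZ.aemeasurable, Or.inl h1⟩, ?_⟩
  rw [integral_eq_lintegral_pos_part_sub_lintegral_neg_part hZ, EReal.coe_sub, expectation,
    EReal.coe_ennreal_toReal h1, EReal.coe_ennreal_toReal h2]

/-- The pair `(Y₁, Y₂)` has the marginal laws `ν₁` and `ν₂`, and `E (Y₁ Y₂ ^ d)` exists and is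
equal to `t`. -/
def HasMixedMoment {Ω : Type*} [MeasurableSpace Ω] (P : Measure Ω) (ν₁ ν₂ : Measure ℝ) (d : ℕ)
    (Y₁ Y₂ : Ω → ℝ) (t : EReal) : Prop :=
  HasLaw Y₁ ν₁ P ∧ HasLaw Y₂ ν₂ P ∧ HasExpectation P (fun ω => Y₁ ω * Y₂ ω ^ d) ∧
    expectation P (fun ω => Y₁ ω * Y₂ ω ^ d) = t

/-- `M`, the supremum of `E (Y₁ Y₂ ^ d)` over all pairs with marginal laws `ν₁` and `ν₂`. -/
def maxMixedMoment {Ω : Type*} [MeasurableSpace Ω] (P : Measure Ω) (ν₁ ν₂ : Measure ℝ)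
    (d : ℕ) : EReal :=
  sSup {t | ∃ Y₁ Y₂ : Ω → ℝ, HasMixedMoment P ν₁ ν₂ d Y₁ Y₂ t}

/-- `m`, the infimum of `E (Y₁ Y₂ ^ d)` over all pairs with marginal laws `ν₁` and `ν₂`. -/
def minMixedMoment {Ω : Type*} [MeasurableSpace Ω] (P : Measure Ω) (ν₁ ν₂ : Measure ℝ)
    (d : ℕ) : EReal :=
  sInf {t | ∃ Y₁ Y₂ : Ω → ℝ, HasMixedMoment P ν₁ ν₂ d Y₁ Y₂ t}

/-- The uniform distribution on `[0, 1]`. -/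
def uniform01 : Measure ℝ := volume.restrict (Set.Icc (0 : ℝ) 1)

/-- `√(u² + 4 e^{-2aλ})`. -/
def expRoot (lam a u : ℝ) : ℝ := √(u ^ 2 + 4 * Real.exp (-2 * a * lam))

/-- The mixing probability `p`, as a function of the value `u` of `U`. -/
def mixProb (lam a u : ℝ) : ℝ :=
  (1 + 4 * Real.exp (-2 * a * lam) / (u - expRoot lam a u) ^ 2) /
    (2 + 4 * Real.exp (-2 * a * lam) / (u + expRoot lam a u) ^ 2 +
      4 * Real.exp (-2 * a * lam) / (u - expRoot lam a u) ^ 2)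

open Classical in
/-- The value of
`U₂ = (1 - I) [J (1 + (U - √(U² + 4 e^{-2aλ})) / 2) + (1 - J) (1 - (U + √(U² + 4 e^{-2aλ})) / 2)] + I U`
at `U = u`, `V = v`, with `I = 1_{U > F₂(a)}` and `J = 1_{V > p}`. -/
def mixU₂ (F₂ : ℝ → ℝ) (lam a u v : ℝ) : ℝ :=
  let I : ℝ := if u > F₂ a then 1 else 0
  let J : ℝ := if v > mixProb lam a u then 1 else 0
  (1 - I) * (J * (1 + (u - expRoot lam a u) / 2) + (1 - J) * (1 - (u + expRoot lam a u) / 2)) +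
    I * u

end

/-! Among all couplings of two given laws the comonotone one maximizes the expected product and the
countermonotone one minimizes it. Applied to the laws of `Y₁` and `Y₂ ^ d`, this gives the bounds.
The comparison is made separately for positive and negative parts, through orthant probabilities
(`lintegral_mul_le_of_monotoneOn`), so it also covers infinite expectations. Comparison with an
independent coupling shows that the extremal expectations exist.

The bounds are attained as soon as `Y₂ ^ d` is a nondecreasing function of `U`. For odd `d` this
holds with `U₂ = U`. For even `d`, `U` has to rank `|Y₂|`, and the sign is drawn with `V`. Write c =
e^{-aλ} and R = √(u² + 4c²). Levels w' < w have opposite quantiles iff (1 - w)(1 - w') = c², and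
{|Y₂| ≤ F₂⁻¹(w)} has probability w - w' = u. Solving gives w = 1 + (u - R)/2 and w' = 1 - (u + R)/2.
Above u = F₂(a) the negative value is no longer in the support, so w = u. The weights dw/du = 1 - p
and -dw'/du = p are exactly those that make `U₂` uniform (`map_mixU₂_prod`), and the even power does
not see the choice of branch (`exists_monotoneOn_pow_quantile_mixU₂`). -/

open Set Filter Topology

/-! ### Comparison of couplings through orthant probabilities -/

/-- The layer cake formula for a product of positive parts. -/
theorem lintegral_ofReal_mul_ofReal_eq (π : Measure (ℝ × ℝ)) [SFinite π] {φ ψ : ℝ → ℝ}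
    (hφ : Measurable φ) (hψ : Measurable ψ) :
    ∫⁻ z, ENNReal.ofReal (φ z.1) * ENNReal.ofReal (ψ z.2) ∂π =
      ∫⁻ w in Ioi (0 : ℝ) ×ˢ Ioi (0 : ℝ), π ({x | w.1 < φ x} ×ˢ {y | w.2 < ψ y})
        ∂(volume.prod volume) := by
  set vol : Measure (ℝ × ℝ) := (volume.prod volume).restrict (Ioi (0 : ℝ) ×ˢ Ioi (0 : ℝ))
  let A : Set ((ℝ × ℝ) × (ℝ × ℝ)) := {q | q.2.1 < φ q.1.1} ∩ {q | q.2.2 < ψ q.1.2}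
  have hA : MeasurableSet A :=
    (measurableSet_lt (by fun_prop) (by fun_prop)).inter
      (measurableSet_lt (by fun_prop) (by fun_prop))
  have h1 := Measure.prod_apply (μ := π) (ν := vol) hA
  rw [Measure.prod_apply_symm hA] at h1
  refine Eq.trans (lintegral_congr fun z => ?_) h1.symm
  have : Prod.mk z ⁻¹' A = Iio (φ z.1) ×ˢ Iio (ψ z.2) := by ext w; simp [A]
  rw [this, Measure.restrict_apply (measurableSet_Iio.prod measurableSet_Iio), prod_inter_prod,
    Measure.prod_prod]
  simp [inter_comm (Iio _), Ioi_inter_Iio]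

/-- For two probability measures with the same marginals, of which the second is larger on products
of upper sets, the same holds on products of lower sets, and the converse on mixed products. -/
theorem measure_prod_le_of_upperSet {π π' : Measure (ℝ × ℝ)} [IsProbabilityMeasure π]
    [IsProbabilityMeasure π'] (h₁ : π.map Prod.fst = π'.map Prod.fst)
    (h₂ : π.map Prod.snd = π'.map Prod.snd)
    (h : ∀ S T : Set ℝ, IsUpperSet S → IsUpperSet T → π (S ×ˢ T) ≤ π' (S ×ˢ T)) :
    (∀ S T : Set ℝ, IsUpperSet S → IsLowerSet T → π' (S ×ˢ T) ≤ π (S ×ˢ T)) ∧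
    (∀ S T : Set ℝ, IsLowerSet S → IsUpperSet T → π' (S ×ˢ T) ≤ π (S ×ˢ T)) ∧
    (∀ S T : Set ℝ, IsLowerSet S → IsLowerSet T → π (S ×ˢ T) ≤ π' (S ×ˢ T)) := by
  have key₁ : ∀ {S : Set ℝ} {T T' : Set ℝ}, MeasurableSet S → MeasurableSet T → T' = Tᶜ →
      ∀ {ρ ρ' : Measure (ℝ × ℝ)} [IsProbabilityMeasure ρ] [IsProbabilityMeasure ρ'],
      ρ.map Prod.fst = ρ'.map Prod.fst → ρ (S ×ˢ T') ≤ ρ' (S ×ˢ T') →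
      ρ' (S ×ˢ T) ≤ ρ (S ×ˢ T) := by
    rintro S T _ hS hT rfl ρ ρ' _ _ he hle
    -- The two rectangles share the marginal mass of `S`, the same for both measures, so an
    -- inequality on one reverses on the other.
    have split : ∀ (τ : Measure (ℝ × ℝ)), τ (S ×ˢ T) + τ (S ×ˢ Tᶜ) = τ.map Prod.fst S := by
      intro τ
      rw [Measure.map_apply measurable_fst hS,
        ← measure_inter_add_sdiff (μ := τ) (Prod.fst ⁻¹' S) (measurable_snd hT)]
      congr 1
    have e := (split ρ).trans ((congrArg (· S) he).trans (split ρ').symm)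
    by_contra! hlt
    refine e.not_lt ?_
    exact ENNReal.add_lt_add_of_lt_of_le (measure_ne_top _ _) hlt hle
  have key₂ : ∀ {S S' : Set ℝ} {T : Set ℝ}, MeasurableSet S → MeasurableSet T → S' = Sᶜ →
      ∀ {ρ ρ' : Measure (ℝ × ℝ)} [IsProbabilityMeasure ρ] [IsProbabilityMeasure ρ'],
      ρ.map Prod.snd = ρ'.map Prod.snd → ρ (S' ×ˢ T) ≤ ρ' (S' ×ˢ T) →
      ρ' (S ×ˢ T) ≤ ρ (S ×ˢ T) := by
    rintro S _ T hS hT rfl ρ ρ' _ _ he hle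
    have split : ∀ (τ : Measure (ℝ × ℝ)), τ (S ×ˢ T) + τ (Sᶜ ×ˢ T) = τ.map Prod.snd T := by
      intro τ
      rw [Measure.map_apply measurable_snd hT,
        ← measure_inter_add_sdiff (μ := τ) (Prod.snd ⁻¹' T) (measurable_fst hS)]
      congr 2
      · rw [inter_comm]; rfl
      · rw [sdiff_eq, inter_comm]; rfl
    have e := (split ρ).trans ((congrArg (· T) he).trans (split ρ').symm)
    by_contra! hlt
    refine e.not_lt ?_
    exact ENNReal.add_lt_add_of_lt_of_le (measure_ne_top _ _) hlt hle
  have mU : ∀ {S : Set ℝ}, IsUpperSet S → MeasurableSet S := fun h => h.ordConnected.measurableSet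
  have mL : ∀ {S : Set ℝ}, IsLowerSet S → MeasurableSet S := fun h => h.ordConnected.measurableSet
  have a : ∀ S T : Set ℝ, IsUpperSet S → IsLowerSet T → π' (S ×ˢ T) ≤ π (S ×ˢ T) :=
    fun S T hS hT => key₁ (mU hS) (mL hT) rfl h₁ (h S _ hS hT.compl)
  exact ⟨a, fun S T hS hT => key₂ (mL hS) (mU hT) rfl h₂ (h _ T hS.compl hT),
    fun S T hS hT => key₂ (mL hS) (mL hT) rfl h₂.symm (a _ T hS.compl hT)⟩

theorem ofReal_mul_eq_add (x y : ℝ) :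
    ENNReal.ofReal (x * y) = ENNReal.ofReal x * ENNReal.ofReal y +
      ENNReal.ofReal (-x) * ENNReal.ofReal (-y) := by
  rcases le_total 0 x with hx | hx
  · rw [ENNReal.ofReal_mul hx, ENNReal.ofReal_of_nonpos (p := -x) (by linarith)]; simp
  · rw [← neg_mul_neg, ENNReal.ofReal_mul (by linarith), ENNReal.ofReal_of_nonpos hx]; simp

/-- Since (xy)⁺ = x⁺y⁺ + x⁻y⁻ and (xy)⁻ = x⁺y⁻ + x⁻y⁺, the layer cake formula reduces each term to
one of the four kinds of rectangles. -/
theorem lintegral_mul_le_of_upperSet {π π' : Measure (ℝ × ℝ)} [IsProbabilityMeasure π]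
    [IsProbabilityMeasure π'] (h₁ : π.map Prod.fst = π'.map Prod.fst)
    (h₂ : π.map Prod.snd = π'.map Prod.snd)
    (h : ∀ S T : Set ℝ, IsUpperSet S → IsUpperSet T → π (S ×ˢ T) ≤ π' (S ×ˢ T)) :
    ∫⁻ z, ENNReal.ofReal (z.1 * z.2) ∂π ≤ ∫⁻ z, ENNReal.ofReal (z.1 * z.2) ∂π' ∧
    ∫⁻ z, ENNReal.ofReal (-(z.1 * z.2)) ∂π' ≤ ∫⁻ z, ENNReal.ofReal (-(z.1 * z.2)) ∂π := by
  obtain ⟨hUL, hLU, hLL⟩ := measure_prod_le_of_upperSet h₁ h₂ h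
  have cmp : ∀ {ρ ρ' : Measure (ℝ × ℝ)} [IsProbabilityMeasure ρ] [IsProbabilityMeasure ρ']
      {φ ψ : ℝ → ℝ}, Measurable φ → Measurable ψ →
      (∀ s t, ρ ({x | s < φ x} ×ˢ {y | t < ψ y}) ≤ ρ' ({x | s < φ x} ×ˢ {y | t < ψ y})) →
      ∫⁻ z, ENNReal.ofReal (φ z.1) * ENNReal.ofReal (ψ z.2) ∂ρ ≤
        ∫⁻ z, ENNReal.ofReal (φ z.1) * ENNReal.ofReal (ψ z.2) ∂ρ' := by
    intro ρ ρ' _ _ φ ψ hφ hψ hle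
    rw [lintegral_ofReal_mul_ofReal_eq _ hφ hψ, lintegral_ofReal_mul_ofReal_eq _ hφ hψ]
    exact lintegral_mono fun w => hle _ _
  have up : ∀ s : ℝ, IsUpperSet {x : ℝ | s < x} := fun s => isUpperSet_Ioi s
  have lo : ∀ s : ℝ, IsLowerSet {x : ℝ | s < -x} := fun s x y hyx hx =>
    lt_of_lt_of_le hx (neg_le_neg hyx)
  have hneg : ∀ x y : ℝ, ENNReal.ofReal (-(x * y)) =
      ENNReal.ofReal x * ENNReal.ofReal (-y) + ENNReal.ofReal (-x) * ENNReal.ofReal y := by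
    intro x y
    rw [← mul_neg, ofReal_mul_eq_add, neg_neg]
  simp only [hneg]
  simp only [ofReal_mul_eq_add]
  rw [lintegral_add_left (by fun_prop), lintegral_add_left (by fun_prop),
    lintegral_add_left (by fun_prop), lintegral_add_left (by fun_prop)]
  exact ⟨add_le_add
      (cmp measurable_id measurable_id fun s t => h _ _ (up s) (up t))
      (cmp measurable_neg measurable_neg fun s t => hLL _ _ (lo s) (lo t)),
    add_le_add
      (cmp measurable_id measurable_neg fun s t => hUL _ _ (up s) (lo t))
      (cmp measurable_neg measurable_id fun s t => hLU _ _ (lo s) (up t))⟩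

/-! ### Rearrangement inequality and quantile transform -/

theorem uniform01_eq_restrict_Ioo : uniform01 = volume.restrict (Ioo (0 : ℝ) 1) :=
  (Measure.restrict_congr_set Ioo_ae_eq_Icc).symm

instance : IsProbabilityMeasure uniform01 := ⟨by simp [uniform01]⟩

theorem ae_mem_Ioo_uniform01 : ∀ᵐ u ∂uniform01, u ∈ Ioo (0 : ℝ) 1 := by
  rw [uniform01_eq_restrict_Ioo]
  exact ae_restrict_mem measurableSet_Ioo

theorem aemeasurable_uniform01_of_monotoneOn {f : ℝ → ℝ} (hf : MonotoneOn f (Ioo 0 1)) :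
    AEMeasurable f uniform01 := by
  rw [uniform01_eq_restrict_Ioo]
  exact aemeasurable_restrict_of_monotoneOn measurableSet_Ioo hf

/-- The rearrangement inequality: the comonotone coupling maximizes the expectation of a product. -/
theorem lintegral_mul_le_of_monotoneOn {Ω : Type*} [MeasurableSpace Ω] {P : Measure Ω}
    [IsProbabilityMeasure P] {X Y : Ω → ℝ} {f k : ℝ → ℝ}
    (hX : AEMeasurable X P) (hY : AEMeasurable Y P)
    (hf : MonotoneOn f (Ioo 0 1)) (hk : MonotoneOn k (Ioo 0 1))
    (hfX : uniform01.map f = P.map X) (hkY : uniform01.map k = P.map Y) :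
    ∫⁻ ω, ENNReal.ofReal (X ω * Y ω) ∂P ≤ ∫⁻ u, ENNReal.ofReal (f u * k u) ∂uniform01 ∧
    ∫⁻ u, ENNReal.ofReal (-(f u * k u)) ∂uniform01 ≤
      ∫⁻ ω, ENNReal.ofReal (-(X ω * Y ω)) ∂P := by
  have hf' := aemeasurable_uniform01_of_monotoneOn hf
  have hk' := aemeasurable_uniform01_of_monotoneOn hk
  have hXY := hX.prodMk hY
  have hfk := hf'.prodMk hk'
  have : IsProbabilityMeasure (P.map fun ω => (X ω, Y ω)) := Measure.isProbabilityMeasure_map hXY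
  have : IsProbabilityMeasure (uniform01.map fun u => (f u, k u)) :=
    Measure.isProbabilityMeasure_map hfk
  have h₁ : (P.map fun ω => (X ω, Y ω)).map Prod.fst =
      (uniform01.map fun u => (f u, k u)).map Prod.fst := by
    rw [AEMeasurable.map_map_of_aemeasurable (by fun_prop) hXY,
      AEMeasurable.map_map_of_aemeasurable (by fun_prop) hfk]
    exact hfX.symm
  have h₂ : (P.map fun ω => (X ω, Y ω)).map Prod.snd =
      (uniform01.map fun u => (f u, k u)).map Prod.snd := by
    rw [AEMeasurable.map_map_of_aemeasurable (by fun_prop) hXY,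
      AEMeasurable.map_map_of_aemeasurable (by fun_prop) hfk]
    exact hkY.symm
  have main := lintegral_mul_le_of_upperSet h₁ h₂ (fun S T hS hT => by
    have hSm := hS.ordConnected.measurableSet
    have hTm := hT.ordConnected.measurableSet
    rw [Measure.map_apply_of_aemeasurable hXY (hSm.prod hTm),
      Measure.map_apply_of_aemeasurable hfk (hSm.prod hTm)]
    have hleS : P ((fun ω => (X ω, Y ω)) ⁻¹' S ×ˢ T) ≤ uniform01 (f ⁻¹' S) := by
      rw [← Measure.map_apply_of_aemeasurable hf' hSm, hfX,
        Measure.map_apply_of_aemeasurable hX hSm]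
      exact measure_mono fun ω h => h.1
    have hleT : P ((fun ω => (X ω, Y ω)) ⁻¹' S ×ˢ T) ≤ uniform01 (k ⁻¹' T) := by
      rw [← Measure.map_apply_of_aemeasurable hk' hTm, hkY,
        Measure.map_apply_of_aemeasurable hY hTm]
      exact measure_mono fun ω h => h.2
    -- Both preimages are upper sets of (0, 1), hence nested. The comonotone coupling therefore
    -- gives the rectangle the smaller of its two marginal probabilities, which no coupling exceeds.
    by_cases hsub : ∀ u ∈ Ioo (0 : ℝ) 1, f u ∈ S → k u ∈ T
    · refine hleS.trans (measure_mono_ae ?_)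
      filter_upwards [ae_mem_Ioo_uniform01] with u hu huS
      exact ⟨huS, hsub u hu huS⟩
    · push Not at hsub
      obtain ⟨v, hv, hvS, hvT⟩ := hsub
      refine hleT.trans (measure_mono_ae ?_)
      filter_upwards [ae_mem_Ioo_uniform01] with u hu huT
      refine ⟨?_, huT⟩
      have hvu : v ≤ u := by
        by_contra! hlt
        exact hvT (hT (hk hu hv hlt.le) huT)
      exact hS (hf hv hu hvu) hvS)
  rw [lintegral_map' (by fun_prop) hXY, lintegral_map' (by fun_prop) hfk,
    lintegral_map' (by fun_prop) hXY, lintegral_map' (by fun_prop) hfk] at main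
  exact main

theorem aemeasurable_uniform01_of_antitoneOn {f : ℝ → ℝ} (hf : AntitoneOn f (Ioo 0 1)) :
    AEMeasurable f uniform01 := by
  exact (aemeasurable_uniform01_of_monotoneOn hf.neg).neg.congr
    (Eventually.of_forall fun u => neg_neg (f u))

theorem quantile_cdf_le_iff (ν : Measure ℝ) {p x : ℝ} (hp : p ∈ Ioo (0 : ℝ) 1) :
    quantile (cdf ν) p ≤ x ↔ p ≤ cdf ν x := by
  set A : Set ℝ := {x : ℝ | p ≤ cdf ν x} with hA
  have hne : A.Nonempty := ((tendsto_cdf_atTop ν).eventually_const_le hp.2).exists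
  have hbdd : BddBelow A := by
    obtain ⟨b, hb⟩ := ((tendsto_cdf_atBot ν).eventually_lt_const hp.1).exists
    refine ⟨b, fun y hy => ?_⟩
    by_contra! hlt
    exact absurd (hy.trans (monotone_cdf ν hlt.le)) (not_le.2 hb)
  -- Right continuity: the infimum is attained.
  have hmem : p ≤ cdf ν (sInf A) := by
    have hc : Tendsto (cdf ν) (𝓝[>] (sInf A)) (𝓝 (cdf ν (sInf A))) :=
      ((cdf ν).right_continuous (sInf A)).mono_left (nhdsWithin_mono _ Ioi_subset_Ici_self)
    refine ge_of_tendsto hc ?_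
    filter_upwards [self_mem_nhdsWithin] with y hy
    obtain ⟨z, hz, hzy⟩ := exists_lt_of_csInf_lt hne hy
    exact hz.trans (monotone_cdf ν hzy.le)
  exact ⟨fun h => hmem.trans (monotone_cdf ν h), fun h => csInf_le hbdd h⟩

theorem monotoneOn_quantile_cdf (ν : Measure ℝ) : MonotoneOn (quantile (cdf ν)) (Ioo 0 1) :=
  fun _ hp _ hq hpq =>
    (quantile_cdf_le_iff ν hp).2 (hpq.trans ((quantile_cdf_le_iff ν hq).1 le_rfl))

/-- The quantile transform. -/
theorem map_quantile_cdf (ν : Measure ℝ) [IsProbabilityMeasure ν] :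
    uniform01.map (quantile (cdf ν)) = ν := by
  have hm := aemeasurable_uniform01_of_monotoneOn (monotoneOn_quantile_cdf ν)
  have := Measure.isProbabilityMeasure_map hm
  refine Measure.ext_of_Iic _ _ fun x => ?_
  rw [Measure.map_apply_of_aemeasurable hm measurableSet_Iic, ← ofReal_cdf ν]
  have : quantile (cdf ν) ⁻¹' Iic x =ᵐ[uniform01] Iic (cdf ν x) := by
    filter_upwards [ae_mem_Ioo_uniform01] with u hu
    exact propext (quantile_cdf_le_iff ν hu)
  rw [measure_congr this, uniform01, Measure.restrict_apply measurableSet_Iic]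
  have : Iic (cdf ν x) ∩ Icc 0 1 = Icc 0 (cdf ν x) := by
    ext y
    have := cdf_le_one ν x
    simp only [mem_inter_iff, mem_Iic, mem_Icc]
    exact ⟨fun h => ⟨h.2.1, h.1⟩, fun h => ⟨h.2, h.1, h.2.trans this⟩⟩
  rw [this]
  simp

theorem map_one_sub_uniform01 : uniform01.map (fun u => 1 - u) = uniform01 := by
  have h : MeasurePreserving (fun u : ℝ => 1 - u) volume volume :=
    Measure.measurePreserving_sub_left _ _
  have h2 := (h.restrict_preimage (s := Icc (0 : ℝ) 1) measurableSet_Icc).map_eq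
  have : (fun u : ℝ => 1 - u) ⁻¹' Icc 0 1 = Icc 0 1 := by
    ext u; simp only [mem_preimage, mem_Icc]; 
    constructor <;> rintro ⟨h1, h2⟩ <;> constructor <;> linarith
  rwa [this] at h2

/-! ### Extremal expectations and their attainment -/

section Expectation

variable {Ω : Type*} [MeasurableSpace Ω] {P : Measure Ω}

theorem expectation_congr_ae {Z Z' : Ω → ℝ} (h : Z =ᵐ[P] Z') :
    expectation P Z = expectation P Z' := by
  have h1 : ∫⁻ ω, ENNReal.ofReal (Z ω) ∂P = ∫⁻ ω, ENNReal.ofReal (Z' ω) ∂P :=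
    lintegral_congr_ae (h.mono fun ω e => by simp only [e])
  have h2 : ∫⁻ ω, ENNReal.ofReal (-Z ω) ∂P = ∫⁻ ω, ENNReal.ofReal (-Z' ω) ∂P :=
    lintegral_congr_ae (h.mono fun ω e => by simp only [e])
  rw [expectation, expectation, h1, h2]

theorem HasExpectation.congr_ae {Z Z' : Ω → ℝ} (hZ : HasExpectation P Z) (h : Z =ᵐ[P] Z') :
    HasExpectation P Z' := by
  have h1 : ∫⁻ ω, ENNReal.ofReal (Z ω) ∂P = ∫⁻ ω, ENNReal.ofReal (Z' ω) ∂P :=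
    lintegral_congr_ae (h.mono fun ω e => by simp only [e])
  have h2 : ∫⁻ ω, ENNReal.ofReal (-Z ω) ∂P = ∫⁻ ω, ENNReal.ofReal (-Z' ω) ∂P :=
    lintegral_congr_ae (h.mono fun ω e => by simp only [e])
  refine ⟨hZ.1.congr h, ?_⟩
  rw [← h1, ← h2]
  exact hZ.2

/-- Subtraction in `EReal` is monotone even where it takes the default value `⊤ - ⊤ = ⊥`, so
existence is not needed. -/
theorem expectation_mono {Z : Ω → ℝ} {Ω' : Type*} [MeasurableSpace Ω'] {P' : Measure Ω'}
    {Z' : Ω' → ℝ}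
    (h : ∫⁻ ω, ENNReal.ofReal (Z ω) ∂P ≤ ∫⁻ ω, ENNReal.ofReal (Z' ω) ∂P')
    (h' : ∫⁻ ω, ENNReal.ofReal (-Z' ω) ∂P' ≤ ∫⁻ ω, ENNReal.ofReal (-Z ω) ∂P) :
    expectation P Z ≤ expectation P' Z' :=
  EReal.sub_le_sub (EReal.coe_ennreal_le_coe_ennreal_iff.2 h)
    (EReal.coe_ennreal_le_coe_ennreal_iff.2 h')

theorem lintegral_comp_hasLaw {U : Ω → ℝ} {μ : Measure ℝ} (hU : HasLaw U μ P) {g : ℝ → ℝ}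
    (hg : AEMeasurable g μ) :
    ∫⁻ u, ENNReal.ofReal (g u) ∂μ = ∫⁻ ω, ENNReal.ofReal (g (U ω)) ∂P := by
  rw [← hU.map_eq] at hg ⊢
  exact lintegral_map' hg.ennreal_ofReal hU.aemeasurable

theorem hasLaw_comp_uniform {U : Ω → ℝ} (hU : HasLaw U uniform01 P) {f : ℝ → ℝ}
    (hf : AEMeasurable f uniform01) : HasLaw (fun ω => f (U ω)) (uniform01.map f) P := by
  rw [← hU.map_eq] at hf
  refine ⟨hf.comp_aemeasurable hU.aemeasurable, ?_⟩
  rw [← hU.map_eq, AEMeasurable.map_map_of_aemeasurable hf hU.aemeasurable]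
  rfl

theorem map_pow_eq_of_hasLaw {Ω : Type*} [MeasurableSpace Ω] {P : Measure Ω} {ν₂ : Measure ℝ}
    {d : ℕ} {Y Y' : Ω → ℝ} (hY : HasLaw Y ν₂ P) (hY' : HasLaw Y' ν₂ P) :
    (P.map fun ω => Y' ω ^ d) = P.map fun ω => Y ω ^ d := by
  have h1 := AEMeasurable.map_map_of_aemeasurable (g := fun x : ℝ => x ^ d) (by fun_prop)
    hY.aemeasurable
  have h2 := AEMeasurable.map_map_of_aemeasurable (g := fun x : ℝ => x ^ d) (by fun_prop)
    hY'.aemeasurable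
  rw [hY.map_eq] at h1
  rw [hY'.map_eq] at h2
  exact h2.symm.trans h1

theorem map_eq_of_pow_ae_eq {Ω : Type*} [MeasurableSpace Ω] {P : Measure Ω} {ν₂ : Measure ℝ}
    {d : ℕ} {Y Y' U : Ω → ℝ} {k' : ℝ → ℝ} (hY : HasLaw Y ν₂ P) (hU : HasLaw U uniform01 P)
    (hk' : MonotoneOn k' (Ioo 0 1)) (hY' : HasLaw Y' ν₂ P)
    (hkY' : (fun ω => Y' ω ^ d) =ᵐ[P] fun ω => k' (U ω)) :
    uniform01.map k' = P.map fun ω => Y ω ^ d := by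
  rw [← map_pow_eq_of_hasLaw hY hY', Measure.map_congr hkY']
  exact (hasLaw_comp_uniform hU (aemeasurable_uniform01_of_monotoneOn hk')).map_eq.symm

theorem map_neg_eq_of_map_eq {f : ℝ → ℝ} {X : Ω → ℝ} (hf : AEMeasurable f uniform01)
    (hX : AEMeasurable X P) (hfX : uniform01.map f = P.map X) :
    uniform01.map (fun u => -f u) = P.map (fun ω => -X ω) := by
  have h1 := AEMeasurable.map_map_of_aemeasurable (g := fun x : ℝ => -x) (by fun_prop) hf
  have h2 := AEMeasurable.map_map_of_aemeasurable (g := fun x : ℝ => -x) (by fun_prop) hX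
  rw [hfX, h2] at h1
  exact h1.symm

variable [IsProbabilityMeasure P]

/-- The negative part of a product of comonotone integrable variables is integrable. -/
theorem lintegral_neg_mul_ne_top_of_monotoneOn {X Y : Ω → ℝ} {f k : ℝ → ℝ}
    (hX : Integrable X P) (hY : Integrable Y P)
    (hf : MonotoneOn f (Ioo 0 1)) (hk : MonotoneOn k (Ioo 0 1))
    (hfX : uniform01.map f = P.map X) (hkY : uniform01.map k = P.map Y) :
    ∫⁻ u, ENNReal.ofReal (-(f u * k u)) ∂uniform01 ≠ ⊤ := by
  -- Independent copies have an integrable product, and its negative part dominates that of the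
  -- comonotone product.
  have hint : Integrable (fun z : Ω × Ω => X z.1 * Y z.2) (P.prod P) := hX.mul_prod hY
  have hX' : (P.prod P).map (fun z => X z.1) = P.map X := by
    have := AEMeasurable.map_map_of_aemeasurable (μ := P.prod P) (f := Prod.fst) (g := X)
      (by simpa using hX.aemeasurable) (by fun_prop)
    simpa [Function.comp_def] using this.symm
  have hY' : (P.prod P).map (fun z => Y z.2) = P.map Y := by
    have := AEMeasurable.map_map_of_aemeasurable (μ := P.prod P) (f := Prod.snd) (g := Y)
      (by simpa using hY.aemeasurable) (by fun_prop)
    simpa [Function.comp_def] using this.symm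
  exact ((lintegral_mul_le_of_monotoneOn (P := P.prod P) hX.aemeasurable.comp_fst
    hY.aemeasurable.comp_snd hf hk (hfX.trans hX'.symm) (hkY.trans hY'.symm)).2.trans_lt
    hint.neg.lintegral_lt_top).ne

theorem expectation_mul_le_of_monotoneOn {X Y U : Ω → ℝ} {f k : ℝ → ℝ}
    (hX : AEMeasurable X P) (hY : AEMeasurable Y P) (hU : HasLaw U uniform01 P)
    (hf : MonotoneOn f (Ioo 0 1)) (hk : MonotoneOn k (Ioo 0 1))
    (hfX : uniform01.map f = P.map X) (hkY : uniform01.map k = P.map Y) :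
    expectation P (fun ω => X ω * Y ω) ≤ expectation P (fun ω => f (U ω) * k (U ω)) := by
  have main := lintegral_mul_le_of_monotoneOn hX hY hf hk hfX hkY
  have hm := (aemeasurable_uniform01_of_monotoneOn hf).mul
    (aemeasurable_uniform01_of_monotoneOn hk)
  rw [lintegral_comp_hasLaw hU (g := fun u => f u * k u) hm,
    lintegral_comp_hasLaw hU (g := fun u => -(f u * k u)) hm.neg] at main
  exact expectation_mono main.1 main.2

theorem expectation_le_mul_of_antitoneOn {X Y U : Ω → ℝ} {f k : ℝ → ℝ}
    (hX : AEMeasurable X P) (hY : AEMeasurable Y P) (hU : HasLaw U uniform01 P)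
    (hf : AntitoneOn f (Ioo 0 1)) (hk : MonotoneOn k (Ioo 0 1))
    (hfX : uniform01.map f = P.map X) (hkY : uniform01.map k = P.map Y) :
    expectation P (fun ω => f (U ω) * k (U ω)) ≤ expectation P (fun ω => X ω * Y ω) := by
  have hf' := aemeasurable_uniform01_of_antitoneOn hf
  have hfX' := map_neg_eq_of_map_eq hf' hX hfX
  -- Negating the first factor makes the pair comonotone and swaps positive and negative parts.
  have main := lintegral_mul_le_of_monotoneOn hX.neg hY hf.neg hk hfX' hkY
  have hm := hf'.mul (aemeasurable_uniform01_of_monotoneOn hk)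
  simp only [Pi.neg_apply, neg_mul, neg_neg] at main
  rw [lintegral_comp_hasLaw hU (g := fun u => f u * k u) hm,
    lintegral_comp_hasLaw hU (g := fun u => -(f u * k u)) hm.neg] at main
  exact expectation_mono main.2 main.1

/-- `k` stands for the quantile function of `Y ^ d`, and `k'` for the monotone function that the
optimal pair realizes. They have the same law, so rearrangement in both directions equates the
expectations without identifying `k` with `k'`. -/
theorem maxMixedMoment_eq_of_monotoneOn {ν₁ ν₂ : Measure ℝ} {d : ℕ}
    {X Y Y' U : Ω → ℝ} {f k k' : ℝ → ℝ}
    (hX : HasLaw X ν₁ P) (hY : HasLaw Y ν₂ P) (hU : HasLaw U uniform01 P)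
    (hXint : Integrable X P) (hYint : Integrable (fun ω => Y ω ^ d) P)
    (hfX : uniform01.map f = ν₁)
    (hk : MonotoneOn k (Ioo 0 1)) (hkY : uniform01.map k = P.map fun ω => Y ω ^ d)
    (hk' : MonotoneOn k' (Ioo 0 1)) (hY' : HasLaw Y' ν₂ P)
    (hkY' : (fun ω => Y' ω ^ d) =ᵐ[P] fun ω => k' (U ω))
    (hf : MonotoneOn f (Ioo 0 1)) :
    (HasExpectation P (fun ω => f (U ω) * k (U ω)) ∧
      maxMixedMoment P ν₁ ν₂ d = expectation P (fun ω => f (U ω) * k (U ω))) ∧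
    HasMixedMoment P ν₁ ν₂ d (fun ω => f (U ω)) Y' (maxMixedMoment P ν₁ ν₂ d) := by
  have hfm := aemeasurable_uniform01_of_monotoneOn hf
  have hfU : HasLaw (fun ω => f (U ω)) ν₁ P := hfX ▸ hasLaw_comp_uniform hU hfm
  have hkY'' := map_eq_of_pow_ae_eq hY hU hk' hY' hkY'
  have hexp : ∀ g : ℝ → ℝ, MonotoneOn g (Ioo 0 1) → (uniform01.map g = P.map fun ω => Y ω ^ d) →
      HasExpectation P (fun ω => f (U ω) * g (U ω)) := by
    intro g hg hgY
    have hgm := aemeasurable_uniform01_of_monotoneOn hg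
    refine ⟨hfU.aemeasurable.mul (hasLaw_comp_uniform hU hgm).aemeasurable, Or.inr ?_⟩
    rw [← lintegral_comp_hasLaw hU (g := fun u => -(f u * g u)) (hfm.mul hgm).neg]
    exact lintegral_neg_mul_ne_top_of_monotoneOn hXint hYint hf hg (hfX.trans hX.map_eq.symm) hgY
  have hae : (fun ω => f (U ω) * Y' ω ^ d) =ᵐ[P] fun ω => f (U ω) * k' (U ω) := by
    filter_upwards [hkY'] with ω h using by rw [h]
  have hbound : ∀ Y₁ Y₂ : Ω → ℝ, HasLaw Y₁ ν₁ P → HasLaw Y₂ ν₂ P →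
      expectation P (fun ω => Y₁ ω * Y₂ ω ^ d) ≤ expectation P (fun ω => f (U ω) * k (U ω)) :=
    fun Y₁ Y₂ h₁ h₂ => expectation_mul_le_of_monotoneOn h₁.aemeasurable
      (h₂.aemeasurable.pow_const d) hU hf hk (hfX.trans h₁.map_eq.symm)
      (hkY.trans (map_pow_eq_of_hasLaw hY h₂).symm)
  have heq : expectation P (fun ω => f (U ω) * Y' ω ^ d) =
      expectation P (fun ω => f (U ω) * k (U ω)) := by
    refine le_antisymm (hbound _ _ hfU hY') ?_
    have hkU := hasLaw_comp_uniform hU (aemeasurable_uniform01_of_monotoneOn hk)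
    rw [expectation_congr_ae hae]
    exact expectation_mul_le_of_monotoneOn hfU.aemeasurable hkU.aemeasurable hU hf hk'
      (hfX.trans hfU.map_eq.symm) (hkY''.trans (hkY.symm.trans hkU.map_eq.symm))
  have hpair : HasMixedMoment P ν₁ ν₂ d (fun ω => f (U ω)) Y'
      (expectation P (fun ω => f (U ω) * k (U ω))) :=
    ⟨hfU, hY', (hexp k' hk' hkY'').congr_ae hae.symm, heq⟩
  have hmax : maxMixedMoment P ν₁ ν₂ d = expectation P (fun ω => f (U ω) * k (U ω)) := by
    refine le_antisymm (sSup_le ?_) (le_sSup ⟨_, _, hpair⟩)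
    rintro t ⟨Y₁, Y₂, h₁, h₂, -, rfl⟩
    exact hbound Y₁ Y₂ h₁ h₂
  exact ⟨⟨hexp k hk hkY, hmax⟩, hmax ▸ hpair⟩

theorem minMixedMoment_eq_of_antitoneOn {ν₁ ν₂ : Measure ℝ} {d : ℕ}
    {X Y Y' U : Ω → ℝ} {f k k' : ℝ → ℝ}
    (hX : HasLaw X ν₁ P) (hY : HasLaw Y ν₂ P) (hU : HasLaw U uniform01 P)
    (hXint : Integrable X P) (hYint : Integrable (fun ω => Y ω ^ d) P)
    (hfX : uniform01.map f = ν₁)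
    (hk : MonotoneOn k (Ioo 0 1)) (hkY : uniform01.map k = P.map fun ω => Y ω ^ d)
    (hk' : MonotoneOn k' (Ioo 0 1)) (hY' : HasLaw Y' ν₂ P)
    (hkY' : (fun ω => Y' ω ^ d) =ᵐ[P] fun ω => k' (U ω))
    (hf : AntitoneOn f (Ioo 0 1)) :
    (HasExpectation P (fun ω => f (U ω) * k (U ω)) ∧
      minMixedMoment P ν₁ ν₂ d = expectation P (fun ω => f (U ω) * k (U ω))) ∧
    HasMixedMoment P ν₁ ν₂ d (fun ω => f (U ω)) Y' (minMixedMoment P ν₁ ν₂ d) := by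
  have hfm := aemeasurable_uniform01_of_antitoneOn hf
  have hfU : HasLaw (fun ω => f (U ω)) ν₁ P := hfX ▸ hasLaw_comp_uniform hU hfm
  have hkY'' := map_eq_of_pow_ae_eq hY hU hk' hY' hkY'
  have hexp : ∀ g : ℝ → ℝ, MonotoneOn g (Ioo 0 1) → (uniform01.map g = P.map fun ω => Y ω ^ d) →
      HasExpectation P (fun ω => f (U ω) * g (U ω)) := by
    intro g hg hgY
    have hgm := aemeasurable_uniform01_of_monotoneOn hg
    refine ⟨hfU.aemeasurable.mul (hasLaw_comp_uniform hU hgm).aemeasurable, Or.inl ?_⟩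
    rw [← lintegral_comp_hasLaw hU (g := fun u => f u * g u) (hfm.mul hgm)]
    have := lintegral_neg_mul_ne_top_of_monotoneOn hXint.neg hYint hf.neg hg
      (map_neg_eq_of_map_eq hfm hX.aemeasurable (hfX.trans hX.map_eq.symm)) hgY
    simpa only [Pi.neg_apply, neg_mul, neg_neg] using this
  have hae : (fun ω => f (U ω) * Y' ω ^ d) =ᵐ[P] fun ω => f (U ω) * k' (U ω) := by
    filter_upwards [hkY'] with ω h using by rw [h]
  have hbound : ∀ Y₁ Y₂ : Ω → ℝ, HasLaw Y₁ ν₁ P → HasLaw Y₂ ν₂ P →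
      expectation P (fun ω => f (U ω) * k (U ω)) ≤ expectation P (fun ω => Y₁ ω * Y₂ ω ^ d) :=
    fun Y₁ Y₂ h₁ h₂ => expectation_le_mul_of_antitoneOn h₁.aemeasurable
      (h₂.aemeasurable.pow_const d) hU hf hk (hfX.trans h₁.map_eq.symm)
      (hkY.trans (map_pow_eq_of_hasLaw hY h₂).symm)
  have heq : expectation P (fun ω => f (U ω) * Y' ω ^ d) =
      expectation P (fun ω => f (U ω) * k (U ω)) := by
    refine le_antisymm ?_ (hbound _ _ hfU hY')
    have hkU := hasLaw_comp_uniform hU (aemeasurable_uniform01_of_monotoneOn hk)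
    rw [expectation_congr_ae hae]
    exact expectation_le_mul_of_antitoneOn hfU.aemeasurable hkU.aemeasurable hU hf hk'
      (hfX.trans hfU.map_eq.symm) (hkY''.trans (hkY.symm.trans hkU.map_eq.symm))
  have hpair : HasMixedMoment P ν₁ ν₂ d (fun ω => f (U ω)) Y'
      (expectation P (fun ω => f (U ω) * k (U ω))) :=
    ⟨hfU, hY', (hexp k' hk' hkY'').congr_ae hae.symm, heq⟩
  have hmin : minMixedMoment P ν₁ ν₂ d = expectation P (fun ω => f (U ω) * k (U ω)) := by
    refine le_antisymm (sInf_le ⟨_, _, hpair⟩) (le_sInf ?_)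
    rintro t ⟨Y₁, Y₂, h₁, h₂, -, rfl⟩
    exact hbound Y₁ Y₂ h₁ h₂
  exact ⟨⟨hexp k hk hkY, hmin⟩, hmin ▸ hpair⟩

end Expectation

/-! ### The two branches of `U₂` for even `d` -/

section MixedUniform

variable (lam a : ℝ)

theorem expRoot_sq (u : ℝ) : expRoot lam a u ^ 2 = u ^ 2 + 4 * Real.exp (-a * lam) ^ 2 := by
  rw [expRoot, Real.sq_sqrt (by positivity), ← Real.exp_nat_mul]
  congr 3
  push_cast
  ring

theorem expRoot_pos (u : ℝ) : 0 < expRoot lam a u := Real.sqrt_pos.2 (by positivity)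

theorem expRoot_eq {u r : ℝ} (hr : 0 ≤ r) (h : r ^ 2 = u ^ 2 + 4 * Real.exp (-a * lam) ^ 2) :
    expRoot lam a u = r :=
  (sq_eq_sq₀ (expRoot_pos lam a u).le hr).1 ((expRoot_sq lam a u).trans h.symm)

theorem abs_lt_expRoot (u : ℝ) : |u| < expRoot lam a u := by
  refine abs_lt_of_sq_lt_sq ?_ (expRoot_pos lam a u).le
  rw [expRoot_sq]
  have := Real.exp_pos (-a * lam)
  nlinarith [pow_pos this 2]

/-- Uses 4e^{-2aλ} = (R - u)(R + u). In this form p is visibly the derivative of (u + R)/2. -/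
theorem mixProb_eq (u : ℝ) :
    mixProb lam a u = (1 + u / expRoot lam a u) / 2 := by
  have h := abs_lt.1 (abs_lt_expRoot lam a u)
  have hR := expRoot_pos lam a u
  have hsq := expRoot_sq lam a u
  have he : 4 * Real.exp (-2 * a * lam) = (expRoot lam a u - u) * (expRoot lam a u + u) := by
    have : Real.exp (-2 * a * lam) = Real.exp (-a * lam) ^ 2 := by
      rw [← Real.exp_nat_mul]; congr 1; push_cast; ring
    rw [this]; linarith
  have h1 : 4 * Real.exp (-2 * a * lam) / (u - expRoot lam a u) ^ 2 =
      (expRoot lam a u + u) / (expRoot lam a u - u) := by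
    rw [he]
    have : expRoot lam a u - u ≠ 0 := by linarith
    have : u - expRoot lam a u ≠ 0 := by linarith
    field_simp
    ring
  have h2 : 4 * Real.exp (-2 * a * lam) / (u + expRoot lam a u) ^ 2 =
      (expRoot lam a u - u) / (expRoot lam a u + u) := by
    rw [he]
    have : expRoot lam a u + u ≠ 0 := by linarith
    have : u + expRoot lam a u ≠ 0 := by linarith
    field_simp
    ring
  rw [mixProb, h1, h2]
  have h3 : expRoot lam a u - u ≠ 0 := by linarith
  have h4 : expRoot lam a u + u ≠ 0 := by linarith
  have h5 : (2 + (expRoot lam a u - u) / (expRoot lam a u + u) +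
      (expRoot lam a u + u) / (expRoot lam a u - u)) =
      (2 * expRoot lam a u) ^ 2 / ((expRoot lam a u + u) * (expRoot lam a u - u)) := by
    field_simp; ring
  have h6 : 1 + (expRoot lam a u + u) / (expRoot lam a u - u) =
      2 * expRoot lam a u / (expRoot lam a u - u) := by
    field_simp; ring
  rw [h5, h6]
  field_simp

theorem mixProb_mem_Icc (u : ℝ) : mixProb lam a u ∈ Icc (0 : ℝ) 1 := by
  have h := abs_lt.1 (abs_lt_expRoot lam a u)
  have hR := expRoot_pos lam a u
  have h1 : -1 ≤ u / expRoot lam a u := by rw [le_div_iff₀ hR]; linarith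
  have h2 : u / expRoot lam a u ≤ 1 := by rw [div_le_iff₀ hR]; linarith
  rw [mixProb_eq]
  constructor <;> linarith

theorem mixU₂_eq_ite (F : ℝ → ℝ) (u v : ℝ) :
    mixU₂ F lam a u v = if F a < u then u else
      if mixProb lam a u < v then 1 + (u - expRoot lam a u) / 2
      else 1 - (u + expRoot lam a u) / 2 := by
  unfold mixU₂
  split_ifs <;> simp

theorem measurable_expRoot : Measurable (expRoot lam a) := by
  unfold expRoot; fun_prop

theorem measurable_mixProb : Measurable (mixProb lam a) := by
  have := measurable_expRoot lam a
  unfold mixProb; fun_prop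

theorem measurable_mixU₂ (F : ℝ → ℝ) :
    Measurable fun z : ℝ × ℝ => mixU₂ F lam a z.1 z.2 := by
  have h1 : Measurable fun z : ℝ × ℝ => expRoot lam a z.1 :=
    (measurable_expRoot lam a).comp measurable_fst
  have h2 : Measurable fun z : ℝ × ℝ => mixProb lam a z.1 :=
    (measurable_mixProb lam a).comp measurable_fst
  simp only [mixU₂_eq_ite]
  refine Measurable.ite (measurableSet_lt (by fun_prop) (by fun_prop)) (by fun_prop) ?_
  exact Measurable.ite (measurableSet_lt (by fun_prop) (by fun_prop)) (by fun_prop) (by fun_prop)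

theorem hasDerivAt_expRoot (u : ℝ) :
    HasDerivAt (expRoot lam a) (u / expRoot lam a u) u := by
  have h1 : HasDerivAt (fun u : ℝ => u ^ 2 + 4 * Real.exp (-2 * a * lam)) (2 * u) u := by
    simpa using (hasDerivAt_pow 2 u).add_const (4 * Real.exp (-2 * a * lam))
  have h2 := h1.sqrt (by positivity)
  rw [mul_div_mul_left _ _ two_ne_zero] at h2
  exact h2

theorem expRoot_sub_lt {u v : ℝ} (h : u < v) : expRoot lam a v - expRoot lam a u < v - u := by
  have hu := abs_lt.1 (abs_lt_expRoot lam a u)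
  have hv := expRoot_pos lam a v
  -- Otherwise squaring R(v) ≥ R(u) + (v - u) would give u ≥ R(u).
  by_contra! hle
  have h1 := expRoot_sq lam a u
  have h2 := expRoot_sq lam a v
  nlinarith [mul_self_le_mul_self (a := expRoot lam a u + (v - u)) (b := expRoot lam a v)
    (by linarith) (by linarith)]

theorem strictMono_upperBranch : StrictMono fun u => 1 + (u - expRoot lam a u) / 2 :=
  fun u v h => by
    have := expRoot_sub_lt lam a h
    simp only
    linarith

theorem strictAnti_lowerBranch : StrictAnti fun u => 1 - (u + expRoot lam a u) / 2 := by
  have hneg : ∀ u, expRoot lam a (-u) = expRoot lam a u := fun u => by simp [expRoot]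
  intro u v h
  have := expRoot_sub_lt lam a (neg_lt_neg h)
  rw [hneg, hneg] at this
  simp only
  linarith

variable {lam a}

theorem image_upperBranch :
    (fun u => 1 + (u - expRoot lam a u) / 2) '' Ioo 0 (1 - Real.exp (-a * lam) ^ 2) =
      Ioo (1 - Real.exp (-a * lam)) (1 - Real.exp (-a * lam) ^ 2) := by
  have hsq := expRoot_sq lam a
  have hR := expRoot_pos lam a
  have heq := fun (u r : ℝ) => expRoot_eq (u := u) (r := r) lam a
  have hc0 := Real.exp_pos (-a * lam)
  generalize Real.exp (-a * lam) = c at *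
  apply Subset.antisymm
  · rintro _ ⟨u, ⟨hu0, hu1⟩, rfl⟩
    have := hsq u
    have := hR u
    have hlt : u + 2 * c ^ 2 < expRoot lam a u := by
      refine lt_of_pow_lt_pow_left₀ 2 this.le ?_
      rw [hsq]
      nlinarith [mul_pos (pow_pos hc0 2) (sub_pos.2 hu1)]
    constructor
    · nlinarith
    · simp only
      linarith
  · rintro w ⟨hw0, hw1⟩
    have hy : 0 < 1 - w := by nlinarith
    have hdiv : c ^ 2 / (1 - w) * (1 - w) = c ^ 2 := by field_simp
    have hpos : 0 < c ^ 2 / (1 - w) := by positivity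
    -- With y = 1 - w, the numbers y = (R - u)/2 and c²/y = (R + u)/2 have difference u and sum R.
    -- On the lower branch their roles are exchanged.
    refine ⟨c ^ 2 / (1 - w) - (1 - w), ⟨?_, ?_⟩, ?_⟩
    · nlinarith
    · nlinarith
    · simp only
      rw [heq _ (c ^ 2 / (1 - w) + (1 - w)) (by linarith) (by nlinarith)]
      ring

theorem image_lowerBranch (hc : Real.exp (-a * lam) < 1) :
    (fun u => 1 - (u + expRoot lam a u) / 2) '' Ioo 0 (1 - Real.exp (-a * lam) ^ 2) =
      Ioo 0 (1 - Real.exp (-a * lam)) := by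
  have hsq := expRoot_sq lam a
  have hR := expRoot_pos lam a
  have heq := fun (u r : ℝ) => expRoot_eq (u := u) (r := r) lam a
  have hc0 := Real.exp_pos (-a * lam)
  generalize Real.exp (-a * lam) = c at *
  apply Subset.antisymm
  · rintro _ ⟨u, ⟨hu0, hu1⟩, rfl⟩
    have := hsq u
    have := hR u
    constructor
    · nlinarith
    · nlinarith
  · rintro w ⟨hw0, hw1⟩
    have hy : 0 < 1 - w := by linarith
    have hdiv : c ^ 2 / (1 - w) * (1 - w) = c ^ 2 := by field_simp
    have hpos : 0 < c ^ 2 / (1 - w) := by positivity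
    refine ⟨(1 - w) - c ^ 2 / (1 - w), ⟨?_, ?_⟩, ?_⟩
    · nlinarith
    · nlinarith
    · simp only
      rw [heq _ (c ^ 2 / (1 - w) + (1 - w)) (by linarith) (by nlinarith)]
      ring

end MixedUniform

/-! ### Uniformity of `U₂` -/

theorem uniform01_preimage_ite {p : ℝ} (hp : p ∈ Icc (0 : ℝ) 1) (x y : ℝ) (S : Set ℝ) :
    uniform01 ((fun v => if p < v then x else y) ⁻¹' S) =
      ENNReal.ofReal (1 - p) * S.indicator 1 x + ENNReal.ofReal p * S.indicator 1 y := by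
  have h1 : uniform01 (Ioi p) = ENNReal.ofReal (1 - p) := by
    rw [uniform01, Measure.restrict_apply measurableSet_Ioi]
    have : Ioi p ∩ Icc 0 1 = Ioc p 1 := by
      ext v; simp only [mem_inter_iff, mem_Ioi, mem_Icc, mem_Ioc]
      exact ⟨fun h => ⟨h.1, h.2.2⟩, fun h => ⟨h.1, hp.1.trans h.1.le, h.2⟩⟩
    rw [this, Real.volume_Ioc]
  have h2 : uniform01 (Iic p) = ENNReal.ofReal p := by
    rw [uniform01, Measure.restrict_apply measurableSet_Iic]
    have : Iic p ∩ Icc 0 1 = Icc 0 p := by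
      ext v; simp only [mem_inter_iff, mem_Iic, mem_Icc]
      exact ⟨fun h => ⟨h.2.1, h.1⟩, fun h => ⟨h.2, h.1, h.2.trans hp.2⟩⟩
    rw [this, Real.volume_Icc, sub_zero]
  by_cases hx : x ∈ S <;> by_cases hy : y ∈ S
  · have : (fun v => if p < v then x else y) ⁻¹' S = univ := by
      ext v; by_cases hv : p < v <;> simp [hv, hx, hy]
    rw [this, measure_univ]
    simp [hx, hy, ← ENNReal.ofReal_add (sub_nonneg.2 hp.2) hp.1]
  · have : (fun v => if p < v then x else y) ⁻¹' S = Ioi p := by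
      ext v; by_cases hv : p < v <;> simp [hv, hx, hy]
    simp [this, h1, hx, hy]
  · have : (fun v => if p < v then x else y) ⁻¹' S = Iic p := by
      ext v; by_cases hv : p < v <;> simp [hv, hx, hy, le_of_not_gt]
    simp [this, h2, hx, hy]
  · have : (fun v => if p < v then x else y) ⁻¹' S = ∅ := by
      ext v; by_cases hv : p < v <;> simp [hv, hx, hy]
    simp [this, hx, hy]

theorem setLIntegral_Ioo_add_Ioo (g : ℝ → ENNReal) {a b c : ℝ} (hab : a ≤ b) (hbc : b ≤ c) :
    ∫⁻ u in Ioo a c, g u = (∫⁻ u in Ioo a b, g u) + ∫⁻ u in Ioo b c, g u := by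
  rw [setLIntegral_congr Ioo_ae_eq_Ioc, setLIntegral_congr Ioo_ae_eq_Ioc,
    setLIntegral_congr (s := Ioo b c) Ioo_ae_eq_Ioc, ← Ioc_union_Ioc_eq_Ioc hab hbc,
    lintegral_union measurableSet_Ioc (Ioc_disjoint_Ioc_of_le le_rfl)]

section

variable {lam a : ℝ}

/-- Change of variables: the probability of choosing a branch is the absolute value of its
derivative. -/
theorem setLIntegral_upperBranch (g : ℝ → ENNReal) :
    ∫⁻ u in Ioo 0 (1 - Real.exp (-a * lam) ^ 2),
        ENNReal.ofReal (1 - mixProb lam a u) * g (1 + (u - expRoot lam a u) / 2) =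
      ∫⁻ w in Ioo (1 - Real.exp (-a * lam)) (1 - Real.exp (-a * lam) ^ 2), g w := by
  rw [← image_upperBranch, lintegral_image_eq_lintegral_abs_deriv_mul measurableSet_Ioo
    (f' := fun u => 1 - mixProb lam a u) _ (strictMono_upperBranch lam a).injective.injOn]
  · refine lintegral_congr fun u => ?_
    rw [abs_of_nonneg (sub_nonneg.2 (mixProb_mem_Icc lam a u).2)]
  · intro u _
    have h := (((hasDerivAt_id u).sub (hasDerivAt_expRoot lam a u)).div_const 2).const_add 1
    rw [show (1 - u / expRoot lam a u) / 2 = 1 - mixProb lam a u by rw [mixProb_eq]; ring] at h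
    exact h.hasDerivWithinAt

theorem setLIntegral_lowerBranch (hc : Real.exp (-a * lam) < 1) (g : ℝ → ENNReal) :
    ∫⁻ u in Ioo 0 (1 - Real.exp (-a * lam) ^ 2),
        ENNReal.ofReal (mixProb lam a u) * g (1 - (u + expRoot lam a u) / 2) =
      ∫⁻ w in Ioo 0 (1 - Real.exp (-a * lam)), g w := by
  rw [← image_lowerBranch hc, lintegral_image_eq_lintegral_abs_deriv_mul measurableSet_Ioo
    (f' := fun u => -mixProb lam a u) _ (strictAnti_lowerBranch lam a).injective.injOn]
  · refine lintegral_congr fun u => ?_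
    rw [abs_neg, abs_of_nonneg (mixProb_mem_Icc lam a u).1]
  · intro u _
    have h := (((hasDerivAt_id u).add (hasDerivAt_expRoot lam a u)).div_const 2).const_sub 1
    rw [← mixProb_eq] at h
    exact h.hasDerivWithinAt

/-- The lower branch fills (0, 1 - c), the upper one (1 - c, 1 - c²), each with Lebesgue measure,
and the identity covers the rest. -/
theorem map_mixU₂_prod {F : ℝ → ℝ} (hc : Real.exp (-a * lam) < 1)
    (hF : F a = 1 - Real.exp (-a * lam) ^ 2) :
    (uniform01.prod uniform01).map (fun z => mixU₂ F lam a z.1 z.2) = uniform01 := by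
  have hc0 := Real.exp_pos (-a * lam)
  have hm := measurable_mixU₂ lam a F
  ext S hS
  rw [Measure.map_apply hm hS, Measure.prod_apply (hm hS)]
  have hS1 : uniform01 S = ∫⁻ u in Ioo (0 : ℝ) 1, S.indicator 1 u := by
    rw [lintegral_indicator_one hS, uniform01_eq_restrict_Ioo]
  rw [hS1, uniform01_eq_restrict_Ioo,
    setLIntegral_Ioo_add_Ioo _ (b := 1 - Real.exp (-a * lam) ^ 2) (by nlinarith) (by nlinarith),
    setLIntegral_Ioo_add_Ioo (S.indicator 1) (b := 1 - Real.exp (-a * lam) ^ 2) (by nlinarith)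
      (by nlinarith), ← uniform01_eq_restrict_Ioo]
  congr 1
  · rw [setLIntegral_Ioo_add_Ioo (S.indicator 1) (b := 1 - Real.exp (-a * lam)) (by linarith)
      (by nlinarith), ← setLIntegral_lowerBranch hc, ← setLIntegral_upperBranch,
      ← lintegral_add_right]
    · refine setLIntegral_congr_fun measurableSet_Ioo fun u hu => ?_
      rw [add_comm, ← uniform01_preimage_ite (mixProb_mem_Icc lam a u)]
      congr 1
      ext v
      simp only [mem_preimage, mixU₂_eq_ite, hF, if_neg (not_lt.2 hu.2.le)]
    · have h1 := measurable_mixProb lam a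
      have h2 := measurable_expRoot lam a
      have h3 : Measurable (S.indicator (1 : ℝ → ENNReal)) := measurable_one.indicator hS
      exact (by fun_prop : Measurable fun u => ENNReal.ofReal (1 - mixProb lam a u)).mul
        (h3.comp (by fun_prop))
  · refine setLIntegral_congr_fun measurableSet_Ioo fun u hu => ?_
    have : Prod.mk u ⁻¹' ((fun z : ℝ × ℝ => mixU₂ F lam a z.1 z.2) ⁻¹' S) = {_v | u ∈ S} := by
      ext v
      simp only [mem_preimage, mixU₂_eq_ite, hF, if_pos hu.1]
      rfl
    rw [this]
    by_cases hu' : u ∈ S <;> simp [hu']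

end

/-! ### The shifted exponential law -/

section Exponential

variable {Ω : Type*} [MeasurableSpace Ω] {P : Measure Ω} [IsProbabilityMeasure P] {lam a : ℝ}
  {X : Ω → ℝ} {ν : Measure ℝ}

theorem cdf_of_add_const_hasLaw_exp (hlam : 0 < lam) (hX : HasLaw X ν P)
    (hXa : HasLaw (fun ω => X ω + a) (expMeasure lam) P) (x : ℝ) :
    cdf ν x = if 0 ≤ x + a then 1 - Real.exp (-(lam * (x + a))) else 0 := by
  have := isProbabilityMeasure_expMeasure hlam
  have hν : IsProbabilityMeasure ν := hX.map_eq ▸ Measure.isProbabilityMeasure_map hX.aemeasurable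
  rw [← cdf_expMeasure_eq hlam, ← ENNReal.ofReal_eq_ofReal_iff (cdf_nonneg _ _) (cdf_nonneg _ _),
    ofReal_cdf, ofReal_cdf, ← hX.map_eq, ← hXa.map_eq,
    Measure.map_apply_of_aemeasurable hX.aemeasurable measurableSet_Iic,
    Measure.map_apply_of_aemeasurable hXa.aemeasurable measurableSet_Iic]
  congr 1
  ext ω
  simp

theorem quantile_of_add_const_hasLaw_exp (hlam : 0 < lam) (hX : HasLaw X ν P)
    (hXa : HasLaw (fun ω => X ω + a) (expMeasure lam) P) {p : ℝ} (hp : p ∈ Ioo (0 : ℝ) 1) :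
    quantile (cdf ν) p = -Real.log (1 - p) / lam - a := by
  refine eq_of_forall_ge_iff fun x => ?_
  rw [quantile_cdf_le_iff ν hp, cdf_of_add_const_hasLaw_exp hlam hX hXa]
  have h1 : 0 < 1 - p := by linarith [hp.2]
  have h2 : Real.log (1 - p) < 0 := Real.log_neg h1 (by linarith [hp.1])
  rw [sub_le_iff_le_add, div_le_iff₀ hlam]
  split_ifs with hx
  · rw [le_sub_comm, ← Real.le_log_iff_exp_le h1]
    constructor <;> intro h <;> linarith
  · refine iff_of_false (not_le.2 hp.1) (not_le.2 ?_)
    nlinarith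

theorem integrable_pow_expMeasure (hlam : 0 < lam) (n : ℕ) :
    Integrable (fun x : ℝ => x ^ n) (expMeasure lam) := by
  have hpdf : Measurable (exponentialPDF lam) := (measurable_exponentialPDFReal lam).ennreal_ofReal
  change Integrable _ (volume.withDensity (exponentialPDF lam))
  rw [integrable_withDensity_iff hpdf (Eventually.of_forall fun x => ENNReal.ofReal_lt_top)]
  have h := (integrableOn_rpow_mul_exp_neg_mul_rpow (p := 1) (s := n) (b := lam)
    (by have : (0 : ℝ) ≤ n := n.cast_nonneg
        linarith) one_pos hlam).const_mul lam
  rw [← IntegrableOn, ← integrableOn_Ici_iff_integrableOn_Ioi,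
    ← integrable_indicator_iff measurableSet_Ici] at h
  refine h.congr (Eventually.of_forall fun x => ?_)
  simp only [exponentialPDF_eq, indicator, mem_Ici]
  split_ifs with hx
  · rw [ENNReal.toReal_ofReal (by positivity)]
    simp only [Real.rpow_natCast, Real.rpow_one, neg_mul]
    ring
  · simp

theorem integrable_pow_of_add_const_hasLaw_exp (hlam : 0 < lam) (hX : AEMeasurable X P)
    (hXa : HasLaw (fun ω => X ω + a) (expMeasure lam) P) {d : ℕ} (hd : d ≠ 0) :
    Integrable (fun ω => X ω ^ d) P := by
  have h1 : Integrable (fun ω => (X ω + a) ^ d) P := by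
    have := integrable_pow_expMeasure hlam d
    rw [← hXa.map_eq] at this
    exact this.comp_aemeasurable hXa.aemeasurable
  -- In L^d the shift is removed by subtracting a constant, with no binomial expansion.
  have h2 : MemLp (fun ω => X ω + a) d P := by
    refine (integrable_norm_rpow_iff hXa.aemeasurable.aestronglyMeasurable (by simpa using hd)
      (by simp)).1 ?_
    simpa using h1.norm
  have h3 : MemLp X d P := by
    refine (h2.sub (memLp_const a)).ae_eq (Eventually.of_forall fun ω => ?_)
    simp
  refine ((h3.integrable_norm_pow hd).mono' (hX.pow_const d).aestronglyMeasurable ?_)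
  exact Eventually.of_forall fun ω => by simp

end Exponential

/-! ### Even powers of the quantile at `U₂` -/

section

variable {Ω : Type*} [MeasurableSpace Ω] {P : Measure Ω}

theorem hasLaw_uniform01_ae_mem_Ioo {U : Ω → ℝ} (hU : HasLaw U uniform01 P) :
    ∀ᵐ ω ∂P, U ω ∈ Ioo (0 : ℝ) 1 := by
  have h := ae_mem_Ioo_uniform01
  rw [← hU.map_eq] at h
  exact ae_of_ae_map hU.aemeasurable h

theorem hasLaw_uniform01_ae_ne {U : Ω → ℝ} (hU : HasLaw U uniform01 P) (x : ℝ) :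
    ∀ᵐ ω ∂P, U ω ≠ x := by
  have h : ∀ᵐ u ∂uniform01, u ≠ x := ae_restrict_of_ae (Measure.ae_ne volume x)
  rw [← hU.map_eq] at h
  exact ae_of_ae_map hU.aemeasurable h

variable [IsProbabilityMeasure P] {lam a : ℝ} {X U V : Ω → ℝ} {ν : Measure ℝ}

theorem cdf_of_add_const_hasLaw_exp_of_nonpos (hlam : 0 < lam) (hX : HasLaw X ν P)
    (hXa : HasLaw (fun ω => X ω + a) (expMeasure lam) P) (ha : a ≤ 0) : cdf ν a = 0 := by
  rw [cdf_of_add_const_hasLaw_exp hlam hX hXa]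
  rcases ha.lt_or_eq with ha | rfl
  · rw [if_neg (by linarith)]
  · simp

theorem cdf_of_add_const_hasLaw_exp_of_pos (hlam : 0 < lam) (hX : HasLaw X ν P)
    (hXa : HasLaw (fun ω => X ω + a) (expMeasure lam) P) (ha : 0 < a) :
    cdf ν a = 1 - Real.exp (-a * lam) ^ 2 := by
  rw [cdf_of_add_const_hasLaw_exp hlam hX hXa, if_pos (by linarith), ← Real.exp_nat_mul]
  congr 2
  push_cast
  ring

theorem exp_neg_mul_lt_one (hlam : 0 < lam) (ha : 0 < a) : Real.exp (-a * lam) < 1 :=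
  Real.exp_lt_one_iff.2 (by nlinarith)

theorem hasLaw_mixU₂ (hlam : 0 < lam) (hX : HasLaw X ν P)
    (hXa : HasLaw (fun ω => X ω + a) (expMeasure lam) P)
    (hU : HasLaw U uniform01 P) (hV : HasLaw V uniform01 P) (hUV : IndepFun U V P) :
    HasLaw (fun ω => mixU₂ (cdf ν) lam a (U ω) (V ω)) uniform01 P := by
  -- For a ≤ 0 the variable is nonnegative and F₂(a) = 0, so `U₂ = U` almost surely.
  rcases le_or_gt a 0 with ha | ha
  · refine hU.congr ?_
    filter_upwards [hasLaw_uniform01_ae_mem_Ioo hU] with ω hω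
    rw [mixU₂_eq_ite, cdf_of_add_const_hasLaw_exp_of_nonpos hlam hX hXa ha, if_pos hω.1]
  · have hm := measurable_mixU₂ lam a (cdf ν)
    have hUVm := hU.aemeasurable.prodMk hV.aemeasurable
    refine ⟨hm.comp_aemeasurable hUVm, ?_⟩
    have h1 := (indepFun_iff_map_prod_eq_prod_map_map hU.aemeasurable hV.aemeasurable).1 hUV
    rw [hU.map_eq, hV.map_eq] at h1
    have h2 := AEMeasurable.map_map_of_aemeasurable hm.aemeasurable hUVm
    rw [h1, map_mixU₂_prod (exp_neg_mul_lt_one hlam ha)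
      (cdf_of_add_const_hasLaw_exp_of_pos hlam hX hXa ha)] at h2
    exact h2.symm

theorem mem_Ioc_upperBranch {u : ℝ} (hu : u ∈ Ioc 0 (1 - Real.exp (-a * lam) ^ 2)) :
    1 + (u - expRoot lam a u) / 2 ∈
      Ioc (1 - Real.exp (-a * lam)) (1 - Real.exp (-a * lam) ^ 2) := by
  have hsq := expRoot_sq lam a u
  have hR := expRoot_pos lam a u
  have hc0 := Real.exp_pos (-a * lam)
  obtain ⟨hu0, hu1⟩ := hu
  generalize Real.exp (-a * lam) = c at *
  have hlt : u + 2 * c ^ 2 ≤ expRoot lam a u := by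
    refine le_of_sq_le_sq ?_ hR.le
    rw [hsq]
    nlinarith [mul_nonneg (pow_pos hc0 2).le (sub_nonneg.2 hu1)]
  constructor
  · nlinarith
  · linarith

/-- The two branches of `mixU₂` correspond to opposite values of the quantile function. -/
theorem log_lowerBranch (u : ℝ) :
    Real.log ((u + expRoot lam a u) / 2) =
      -2 * a * lam - Real.log (-((u - expRoot lam a u) / 2)) := by
  have h := abs_lt.1 (abs_lt_expRoot lam a u)
  have h1 : (u + expRoot lam a u) / 2 ≠ 0 := by linarith
  have h2 : -((u - expRoot lam a u) / 2) ≠ 0 := by linarith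
  rw [eq_sub_iff_add_eq, ← Real.log_mul h1 h2, ← Real.log_exp (-2 * a * lam)]
  congr 1
  have hsq := expRoot_sq lam a u
  have : Real.exp (-2 * a * lam) = Real.exp (-a * lam) ^ 2 := by
    rw [← Real.exp_nat_mul]; congr 1; push_cast; ring
  rw [this]
  linarith

/-- The two branches have opposite quantiles, so an even power does not depend on `v`; on the upper
branch the quantile is nonnegative and nondecreasing. The point u = F₂(a) is left out because, for a
> 0, the lower branch is 0 there, outside the range of the quantile formula. -/
theorem exists_monotoneOn_pow_quantile_mixU₂ (hlam : 0 < lam) (hX : HasLaw X ν P)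
    (hXa : HasLaw (fun ω => X ω + a) (expMeasure lam) P) {d : ℕ} (hd : Even d) :
    ∃ k : ℝ → ℝ, MonotoneOn k (Ioo 0 1) ∧ ∀ u ∈ Ioo (0 : ℝ) 1, u ≠ cdf ν a → ∀ v,
      quantile (cdf ν) (mixU₂ (cdf ν) lam a u v) ^ d = k u := by
  have hq := fun p (hp : p ∈ Ioo (0 : ℝ) 1) => quantile_of_add_const_hasLaw_exp hlam hX hXa hp
  have hmono := monotoneOn_quantile_cdf ν
  have hnonneg : ∀ p ∈ Ioo (0 : ℝ) 1, 1 - p ≤ Real.exp (-a * lam) → 0 ≤ quantile (cdf ν) p := by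
    intro p hp hle
    rw [hq p hp]
    have := (Real.log_le_iff_le_exp (by linarith [hp.2])).2 hle
    rw [sub_nonneg, le_div_iff₀ hlam]
    linarith
  have hc0 := Real.exp_pos (-a * lam)
  rcases le_or_gt a 0 with ha | ha
  · refine ⟨fun u => quantile (cdf ν) u ^ d, ?_, ?_⟩
    · intro u hu v hv huv
      refine pow_le_pow_left₀ (hnonneg u hu ?_) (hmono hu hv huv) d
      exact (by linarith [hu.1] : 1 - u ≤ 1).trans (Real.one_le_exp (by nlinarith))
    · intro u hu _ v
      rw [mixU₂_eq_ite, cdf_of_add_const_hasLaw_exp_of_nonpos hlam hX hXa ha, if_pos hu.1]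
  · have hc1 := exp_neg_mul_lt_one hlam ha
    have hF := cdf_of_add_const_hasLaw_exp_of_pos hlam hX hXa ha
    set w : ℝ → ℝ := fun u => if cdf ν a < u then u else 1 + (u - expRoot lam a u) / 2 with hw
    have hwmem : ∀ u ∈ Ioo (0 : ℝ) 1, 1 - Real.exp (-a * lam) ≤ w u ∧ w u ∈ Ioo (0 : ℝ) 1 := by
      intro u hu
      simp only [hw, hF]
      split_ifs with h
      · exact ⟨by nlinarith, hu⟩
      · have := mem_Ioc_upperBranch (lam := lam) (a := a) ⟨hu.1, not_lt.1 h⟩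
        exact ⟨this.1.le, by linarith [this.1], by nlinarith [this.2]⟩
    have hwmono : MonotoneOn w (Ioo 0 1) := by
      intro u hu v hv huv
      simp only [hw, hF]
      split_ifs with h h' h'
      · exact huv
      · linarith
      · exact (mem_Ioc_upperBranch (lam := lam) (a := a) ⟨hu.1, not_lt.1 h⟩).2.trans h'.le
      · exact (strictMono_upperBranch lam a).monotone huv
    refine ⟨fun u => quantile (cdf ν) (w u) ^ d, ?_, ?_⟩
    · intro u hu v hv huv
      have h1 := hwmem u hu
      exact pow_le_pow_left₀ (hnonneg _ h1.2 (by linarith [h1.1]))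
        (hmono h1.2 (hwmem v hv).2 (hwmono hu hv huv)) d
    · intro u hu hne v
      have hwu := (hwmem u hu).2
      rw [mixU₂_eq_ite]
      simp only [hw] at hwu ⊢
      split_ifs with h h'
      · rfl
      · rfl
      · rw [if_neg h] at hwu
        have hR := abs_lt.1 (abs_lt_expRoot lam a u)
        have hlow : 1 - (u + expRoot lam a u) / 2 ∈ Ioo (0 : ℝ) 1 := by
          refine ⟨?_, by linarith⟩
          have hlt : u < 1 - Real.exp (-a * lam) ^ 2 := hF ▸ (not_lt.1 h).lt_of_ne hne
          have hsq := expRoot_sq lam a u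
          -- Squared, this is u < 1 - c².
          have : expRoot lam a u < 2 - u := lt_of_pow_lt_pow_left₀ 2 (by linarith [hu.2]) (by
            rw [hsq]; linarith)
          linarith
        rw [hq _ hlow, hq _ hwu, ← Even.neg_pow hd, sub_sub_cancel, log_lowerBranch,
          sub_add_cancel_left]
        congr 1
        field_simp
        ring

end

theorem mainTheorem7 {Ω : Type*} [MeasurableSpace Ω] (P : Measure Ω) [IsProbabilityMeasure P]
    (lam a : ℝ) (hlam : 0 < lam) (d : ℕ) (hd : 0 < d)
    (X₁ X₂ U V : Ω → ℝ) (ν₁ ν₂ : Measure ℝ)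
    (hX₁ : HasLaw X₁ ν₁ P) (hX₁int : Integrable X₁ P)
    (hX₂ : HasLaw X₂ ν₂ P) (hX₂exp : HasLaw (fun ω => X₂ ω + a) (expMeasure lam) P)
    (hU : HasLaw U uniform01 P) (hV : HasLaw V uniform01 P) (hUV : IndepFun U V P)
    (F₁ F₂ G₂ : ℝ → ℝ) (hF₁ : F₁ = cdf ν₁) (hF₂ : F₂ = cdf ν₂)
    (hG₂ : G₂ = cdf (P.map (fun ω => X₂ ω ^ d)))
    (U₂ : Ω → ℝ)
    (hU₂_even : Even d → ∀ ω, U₂ ω = mixU₂ F₂ lam a (U ω) (V ω))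
    (hU₂_odd : Odd d → ∀ ω, U₂ ω = U ω) :
    -- the value of the upper bound
    (HasExpectation P (fun ω => quantile F₁ (U ω) * quantile G₂ (U ω)) ∧
      maxMixedMoment P ν₁ ν₂ d =
        expectation P (fun ω => quantile F₁ (U ω) * quantile G₂ (U ω))) ∧
    -- the upper bound is attained with `U₁ = U` and `U₂`
    HasMixedMoment P ν₁ ν₂ d (fun ω => quantile F₁ (U ω)) (fun ω => quantile F₂ (U₂ ω))
      (maxMixedMoment P ν₁ ν₂ d) ∧
    -- the value of the lower bound
    (HasExpectation P (fun ω => quantile F₁ (1 - U ω) * quantile G₂ (U ω)) ∧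
      minMixedMoment P ν₁ ν₂ d =
        expectation P (fun ω => quantile F₁ (1 - U ω) * quantile G₂ (U ω))) ∧
    -- the lower bound is attained with `U₁ = 1 - U` and `U₂`
    HasMixedMoment P ν₁ ν₂ d (fun ω => quantile F₁ (1 - U ω)) (fun ω => quantile F₂ (U₂ ω))
      (minMixedMoment P ν₁ ν₂ d) ∧
    -- `1 - U` and `U₂` are uniform, so that both pairs `(U₁, U₂)` follow a copula
    HasLaw (fun ω => 1 - U ω) uniform01 P ∧ HasLaw U₂ uniform01 P := by
  subst hF₁ hF₂ hG₂
  have : IsProbabilityMeasure ν₁ :=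
    hX₁.map_eq ▸ Measure.isProbabilityMeasure_map hX₁.aemeasurable
  have : IsProbabilityMeasure ν₂ :=
    hX₂.map_eq ▸ Measure.isProbabilityMeasure_map hX₂.aemeasurable
  have : IsProbabilityMeasure (P.map fun ω => X₂ ω ^ d) :=
    Measure.isProbabilityMeasure_map (hX₂.aemeasurable.pow_const d)
  have hU₁ : HasLaw (fun ω => 1 - U ω) uniform01 P := by
    have := hasLaw_comp_uniform hU (f := fun u => 1 - u) (by fun_prop)
    rwa [map_one_sub_uniform01] at this
  have hU₂ : HasLaw U₂ uniform01 P := by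
    rcases Nat.even_or_odd d with h | h
    · rw [funext (hU₂_even h)]
      exact hasLaw_mixU₂ hlam hX₂ hX₂exp hU hV hUV
    · rwa [funext (hU₂_odd h)]
  have hY : HasLaw (fun ω => quantile (cdf ν₂) (U₂ ω)) ν₂ P := by
    have := hasLaw_comp_uniform hU₂
      (aemeasurable_uniform01_of_monotoneOn (monotoneOn_quantile_cdf ν₂))
    rwa [map_quantile_cdf] at this
  obtain ⟨k, hk, hkY⟩ : ∃ k : ℝ → ℝ, MonotoneOn k (Ioo 0 1) ∧
      (fun ω => quantile (cdf ν₂) (U₂ ω) ^ d) =ᵐ[P] fun ω => k (U ω) := by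
    rcases Nat.even_or_odd d with h | h
    · obtain ⟨k, hk, hk'⟩ := exists_monotoneOn_pow_quantile_mixU₂ hlam hX₂ hX₂exp h
      refine ⟨k, hk, ?_⟩
      filter_upwards [hasLaw_uniform01_ae_mem_Ioo hU, hasLaw_uniform01_ae_ne hU (cdf ν₂ a)]
        with ω hω hω'
      rw [hU₂_even h, hk' _ hω hω']
    · refine ⟨fun u => quantile (cdf ν₂) u ^ d,
        fun u hu v hv huv => h.strictMono_pow.monotone (monotoneOn_quantile_cdf ν₂ hu hv huv),
        Eventually.of_forall fun ω => ?_⟩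
      simp only [hU₂_odd h]
  have hint := integrable_pow_of_add_const_hasLaw_exp hlam hX₂.aemeasurable hX₂exp hd.ne'
  have hf := monotoneOn_quantile_cdf ν₁
  -- For the minimum only the first factor is reversed; `U₂`, and with it `k`, is unchanged.
  have hf' : AntitoneOn (fun u => quantile (cdf ν₁) (1 - u)) (Ioo 0 1) := fun u hu v hv huv =>
    hf ⟨by linarith [hv.2], by linarith [hv.1]⟩ ⟨by linarith [hu.2], by linarith [hu.1]⟩
      (by linarith)
  have hmap' : uniform01.map (fun u => quantile (cdf ν₁) (1 - u)) = ν₁ := by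
    have h := AEMeasurable.map_map_of_aemeasurable (μ := uniform01) (f := fun u => 1 - u)
      (g := quantile (cdf ν₁))
      (by rw [map_one_sub_uniform01]; exact aemeasurable_uniform01_of_monotoneOn hf) (by fun_prop)
    rw [map_one_sub_uniform01, map_quantile_cdf] at h
    exact h.symm
  have hmax := maxMixedMoment_eq_of_monotoneOn hX₁ hX₂ hU hX₁int hint (map_quantile_cdf ν₁)
    (monotoneOn_quantile_cdf _) (map_quantile_cdf _) hk hY hkY hf
  have hmin := minMixedMoment_eq_of_antitoneOn hX₁ hX₂ hU hX₁int hint hmap'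
    (monotoneOn_quantile_cdf _) (map_quantile_cdf _) hk hY hkY hf'
  exact ⟨hmax.1, hmax.2, hmin.1, hmin.2, hU₁, hU₂⟩
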